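/- Let $B\subseteq\mathbb{R}^2$ be open and let $\delta\xi = F_1\,dx_1 + F_2\,dx_2$ be a Pfaffian form on $B$, where $F_1,F_2: B\to\mathbb{R}$ are of class $C^\infty$. Assume that $\delta\xi$ is non-singular in the sense that it vanishes at no point of $B$: for every $x\in B$, $(F_1(x),F_2(x))\neq(0,0)$. Then $\delta\xi$ is locally integrable on $B$: for every point $p\in B$ there are an open neighbourhood $M\subseteq B$ of $p$ and functions $\mu,\psi: M\to\mathbb{R}$ of class $C^\infty$ such that $\mu(x)\neq 0$ for every $x\in M$ and $$\delta\xi = \mu\,d\psi \quad\text{on } M,$$ that is, $F_i = \mu\,\partial\psi/\partial x_i$ on $M$ for $i=1,2$. -/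

import Mathlib

open scoped ContDiff

/-- A Pfaffian form `F₁ dx₁ + ⋯ + Fₙ dxₙ` in `n` variables on a set `B ⊆ ℝⁿ`: its coefficient
functions, which are of class `C^∞` on `B`. Values off `B` are irrelevant. -/
structure PfaffianForm (n : ℕ) (B : Set (EuclideanSpace ℝ (Fin n))) where
  coeff : Fin n → EuclideanSpace ℝ (Fin n) → ℝ
  smooth : ∀ i, ContDiffOn ℝ ∞ (coeff i) B

namespace PfaffianForm

variable {n : ℕ} {B : Set (EuclideanSpace ℝ (Fin n))}

/-- The covector `∑ i, Fᵢ(x) dxᵢ` at the point `x`; `EuclideanSpace.proj i` is the coordinate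
differential `dxᵢ`. -/
noncomputable def toCovector (ξ : PfaffianForm n B) (x : EuclideanSpace ℝ (Fin n)) :
    EuclideanSpace ℝ (Fin n) →L[ℝ] ℝ :=
  ∑ i, ξ.coeff i x • (EuclideanSpace.proj i : EuclideanSpace ℝ (Fin n) →L[ℝ] ℝ)

/-- The form vanishes at no point of `B`. -/
def NonSingular (ξ : PfaffianForm n B) : Prop :=
  ∀ x ∈ B, ξ.toCovector x ≠ 0

/-- `ξ = μ dψ` on `A`, with `C^∞` functions `μ`, `ψ` on `A` and `μ` without zeros on `A`. -/
def IntegrableOn (ξ : PfaffianForm n B) (A : Set (EuclideanSpace ℝ (Fin n))) : Prop :=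
  ∃ μ ψ : EuclideanSpace ℝ (Fin n) → ℝ,
    ContDiffOn ℝ ∞ μ A ∧ ContDiffOn ℝ ∞ ψ A ∧ (∀ x ∈ A, μ x ≠ 0) ∧
      ∀ x ∈ A, ξ.toCovector x = μ x • fderiv ℝ ψ x

/-- Every point of `B` has an open neighbourhood in `B` on which the form is integrable. -/
def LocallyIntegrable (ξ : PfaffianForm n B) : Prop :=
  ∀ p ∈ B, ∃ M : Set (EuclideanSpace ℝ (Fin n)),
    IsOpen M ∧ p ∈ M ∧ M ⊆ B ∧ ξ.IntegrableOn M

end PfaffianForm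

open Filter Topology Set

/-! At each point the kernel of the form is a line, spanned by the nowhere zero field `kernelField`.
Straightening this field by its flow gives a function `ψ` that is constant along it, with `dψ ≠ 0`
(`exists_local_first_integral`). In a plane, covectors killing the same nonzero vector are
proportional (`eq_div_smul_of_apply_eq_zero`), which gives `μ`.

The analytic core is smoothness of the flow in time and initial value jointly
(`exists_smooth_local_flow`). With time rescaled to `[0, 1]`, integral curves are the zeros of a
smooth map on a Banach space of continuous curves; at time `0` its derivative in the curve is the
identity, so the inverse function theorem solves for the curve smoothly. -/

/-- **Inverse function theorem**, with an inverse that is smooth on a neighbourhood and not only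
at the base point. -/
theorem exists_localInverse_eventually_contDiffAt {E F : Type*}
    [NormedAddCommGroup E] [NormedSpace ℝ E] [CompleteSpace E]
    [NormedAddCommGroup F] [NormedSpace ℝ F] {f : E → F} {f' : E ≃L[ℝ] F} {a : E}
    (hf : ∀ᶠ x in 𝓝 a, ContDiffAt ℝ ∞ f x) (hf' : HasFDerivAt f (f' : E →L[ℝ] F) a) :
    ∃ g : F → E, g (f a) = a ∧ (∀ᶠ y in 𝓝 (f a), ContDiffAt ℝ ∞ g y) ∧
      (∀ᶠ x in 𝓝 a, g (f x) = x) ∧ ∀ᶠ y in 𝓝 (f a), f (g y) = y := by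
  have hfa : ContDiffAt ℝ ∞ f a := hf.self_of_nhds
  have hs : HasStrictFDerivAt f (f' : E →L[ℝ] F) a := hfa.hasStrictFDerivAt' hf' (by simp)
  let h := hs.toOpenPartialHomeomorph f
  refine ⟨h.symm, hs.localInverse_apply_image, ?_, hs.eventually_left_inverse,
    hs.eventually_right_inverse⟩
  -- Invertible operators form an open set, so the inverse is smooth at nearby points too.
  have hinv : ∀ᶠ x in 𝓝 a, fderiv ℝ f x ∈ range ((↑) : (E ≃L[ℝ] F) → E →L[ℝ] F) := by
    have hc : ContinuousAt (fderiv ℝ f) a := (hfa.fderiv_right (m := 0) (by simp)).continuousAt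
    refine hc.eventually ?_
    rw [hf'.fderiv]
    exact f'.nhds
  have htarget : h.target ∈ 𝓝 (f a) :=
    h.open_target.mem_nhds hs.image_mem_toOpenPartialHomeomorph_target
  filter_upwards [htarget, hs.localInverse_tendsto.eventually (hf.and hinv)]
    with y hy ⟨hsmooth, e, he⟩
  refine h.contDiffAt_symm (f₀' := e) hy ?_ hsmooth
  rw [he]
  exact (hsmooth.differentiableAt (by simp)).hasFDerivAt

/-! ### Calculus on spaces of continuous functions -/

namespace ContinuousMap

universe u

section Superposition

variable {K : Type*} [TopologicalSpace K] [CompactSpace K]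
  {E F : Type u} [NormedAddCommGroup E] [NormedSpace ℝ E] [NormedAddCommGroup F] [NormedSpace ℝ F]

variable (K E F) in
/-- A continuous family of continuous linear maps acts on continuous functions pointwise. -/
noncomputable def pointwiseApplyL : C(K, E →L[ℝ] F) →L[ℝ] C(K, E) →L[ℝ] C(K, F) :=
  LinearMap.mkContinuous₂
    (LinearMap.mk₂ ℝ
      (fun (A : C(K, E →L[ℝ] F)) (h : C(K, E)) => (⟨fun x => A x (h x), by fun_prop⟩ : C(K, F)))
      (fun _ _ _ => by ext; simp) (fun _ _ _ => by ext; simp)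
      (fun _ _ _ => by ext; simp) (fun _ _ _ => by ext; simp)) 1
    (fun A h => by
      rw [one_mul]
      refine (norm_le _ (by positivity)).2 fun x => ?_
      exact (A x).le_of_opNorm_le_of_le (A.norm_coe_le_norm x) (h.norm_coe_le_norm x))

@[simp]
theorem pointwiseApplyL_apply (A : C(K, E →L[ℝ] F)) (h : C(K, E)) (x : K) :
    pointwiseApplyL K E F A h x = A x (h x) := rfl

/-- Composition with a `C^1` map is differentiable on `C(K, E)`. -/
theorem hasFDerivAt_comp_left {g : C(E, F)} {g' : C(E, E →L[ℝ] F)}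
    (hg : ∀ a, HasFDerivAt g (g' a) a) (u : C(K, E)) :
    HasFDerivAt (fun v : C(K, E) => g.comp v) (pointwiseApplyL K E F (g'.comp u)) u := by
  rw [hasFDerivAt_iff_isLittleO, Asymptotics.isLittleO_iff]
  intro ε hε
  have hcont : Continuous fun v : C(K, E) => g'.comp v := continuous_postcomp g'
  obtain ⟨δ, hδ, hclose⟩ := Metric.continuousAt_iff (f := fun v : C(K, E) => g'.comp v)
    (a := u) |>.1 hcont.continuousAt ε hε
  filter_upwards [Metric.ball_mem_nhds u hδ] with v hv
  refine (norm_le _ (by positivity)).2 fun x => ?_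
  have hvx : v x ∈ Metric.ball (u x) δ := (dist_apply_le_dist x).trans_lt hv
  have key := (convex_ball (u x) δ).norm_image_sub_le_of_norm_hasFDerivWithin_le'
    (f := g) (f' := g') (φ := g' (u x)) (C := ε) (fun a _ => (hg a).hasFDerivWithinAt)
    (fun a ha => ?_) (Metric.mem_ball_self hδ) hvx
  · refine le_trans (le_of_eq ?_) (key.trans ?_)
    · simp
    · gcongr
      exact (v - u).norm_coe_le_norm x
  -- Shifting `u` by a constant moves its value at `x` to `a`, so closeness in the sup norm bounds
  -- `g' a - g' (u x)`, uniformly in `x`.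
  · have hw : dist (u + const K (a - u x)) u < δ := by
      rw [dist_eq_norm, add_sub_cancel_left]
      refine lt_of_le_of_lt ((norm_le (const K (a - u x)) (norm_nonneg (a - u x))).2
        fun _ => le_rfl) ?_
      rwa [Metric.mem_ball, dist_eq_norm] at ha
    have := (dist_apply_le_dist (f := g'.comp (u + const K (a - u x))) (g := g'.comp u) x).trans
      (hclose hw).le
    simpa [dist_eq_norm] using this

/-- Composition with a smooth map is a smooth operator on `C(K, E)`. -/
theorem contDiff_comp_left (g : C(E, F)) (hg : ContDiff ℝ ∞ g) :
    ContDiff ℝ ∞ fun v : C(K, E) => g.comp v := by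
  refine contDiff_infty.2 fun n => ?_
  -- The derivative is again a superposition operator, with values in `E →L[ℝ] F`; hence `F` varies,
  -- and `E`, `F` share a universe.
  induction n generalizing F with
  | zero => exact contDiff_zero.2 (continuous_postcomp g)
  | succ n ih =>
    have hg' : ContDiff ℝ ∞ (fderiv ℝ g) := hg.fderiv_right (by simp)
    let g' : C(E, E →L[ℝ] F) := ⟨fderiv ℝ g, hg'.continuous⟩
    have hL : ContDiff ℝ n (pointwiseApplyL K E F) := by
      apply ContinuousLinearMap.contDiff
    have hcomp : ContDiff ℝ n fun v : C(K, E) => g'.comp v := ih g' hg'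
    refine contDiff_succ_iff_hasFDerivAt.2 ⟨fun v => pointwiseApplyL K E F (g'.comp v),
      hL.comp hcomp, fun u => ?_⟩
    exact hasFDerivAt_comp_left (fun a => (hg.differentiable (by simp) a).hasFDerivAt) u

end Superposition

section Rescale

variable {E : Type*} [NormedAddCommGroup E]

/-- The function `τ ↦ u (s τ)`. -/
def rescale (s : unitInterval) (u : C(unitInterval, E)) : C(unitInterval, E) :=
  u.comp ⟨fun τ => s * τ, by fun_prop⟩

@[simp]
theorem rescale_apply (s : unitInterval) (u : C(unitInterval, E)) (τ : unitInterval) :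
    rescale s u τ = u (s * τ) := rfl

theorem norm_rescale_sub_const_le (s : unitInterval) (u : C(unitInterval, E)) (x : E) :
    ‖rescale s u - const unitInterval x‖ ≤ ‖u - const unitInterval x‖ :=
  (norm_le _ (norm_nonneg _)).2 fun τ => (u - const unitInterval x).norm_coe_le_norm (s * τ)

end Rescale

section Primitive

variable {E : Type*} [NormedAddCommGroup E] [NormedSpace ℝ E]

variable (E) in
/-- The primitive on `[0, 1]` vanishing at `0`, as a continuous linear operator. -/
noncomputable def primitiveL : C(unitInterval, E) →L[ℝ] C(unitInterval, E) :=
  LinearMap.mkContinuous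
    { toFun := fun u => ⟨fun s => ∫ τ in (0 : ℝ)..s, u.IccExtend zero_le_one τ,
        (intervalIntegral.continuous_primitive
          (fun _ _ => (u.IccExtend zero_le_one).continuous.intervalIntegrable _ _) 0).comp
          continuous_subtype_val⟩
      map_add' := fun u v => by
        ext s
        exact intervalIntegral.integral_add
          ((u.IccExtend zero_le_one).continuous.intervalIntegrable _ _)
          ((v.IccExtend zero_le_one).continuous.intervalIntegrable _ _)
      map_smul' := fun c u => by
        ext s
        exact intervalIntegral.integral_smul c _ } 1
    (fun u => by
      rw [one_mul]
      refine (norm_le _ (norm_nonneg _)).2 fun s => ?_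
      have := intervalIntegral.norm_integral_le_of_norm_le_const (a := 0) (b := (s : ℝ))
        (f := u.IccExtend zero_le_one) (C := ‖u‖) fun τ _ => u.norm_coe_le_norm _
      refine this.trans ?_
      rw [sub_zero, abs_of_nonneg s.2.1]
      exact mul_le_of_le_one_right (norm_nonneg _) s.2.2)

theorem primitiveL_apply (u : C(unitInterval, E)) (s : unitInterval) :
    primitiveL E u s = ∫ τ in (0 : ℝ)..s, u.IccExtend zero_le_one τ := rfl

theorem primitiveL_rescale (s : unitInterval) (u : C(unitInterval, E)) (τ : unitInterval) :
    (s : ℝ) • primitiveL E (rescale s u) τ = primitiveL E u (s * τ) := by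
  rw [primitiveL_apply, primitiveL_apply, Icc.coe_mul]
  have h := intervalIntegral.smul_integral_comp_mul_left (a := 0) (b := (τ : ℝ))
    (u.IccExtend zero_le_one) (s : ℝ)
  rw [mul_zero] at h
  rw [← h]
  congr 1
  refine intervalIntegral.integral_congr fun σ hσ => ?_
  rw [uIcc_of_le τ.2.1] at hσ
  have hσ' : σ ∈ Icc (0 : ℝ) 1 := ⟨hσ.1, hσ.2.trans τ.2.2⟩
  have hsσ : (s : ℝ) * σ ∈ Icc (0 : ℝ) 1 := unitInterval.mul_mem s.2 hσ'
  change Set.IccExtend _ (rescale s u) σ = Set.IccExtend _ u (s * σ)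
  rw [Set.IccExtend_of_mem _ _ hσ', Set.IccExtend_of_mem _ _ hsσ]
  rfl

end Primitive

end ContinuousMap

/-! ### Smooth local flows -/

section Flow

universe u

variable {E : Type u} [NormedAddCommGroup E] [NormedSpace ℝ E]

open ContinuousMap in
/-- The defect of `u` in the integral equation `u(s) = x + t ∫₀ˢ V(u(τ)) dτ`, whose solutions are the
integral curves of `V` from `x`, with time rescaled by `t`. -/
noncomputable def integralDefect (V : C(E, E)) (z : (ℝ × E) × C(unitInterval, E)) :
    C(unitInterval, E) :=
  z.2 - ContinuousLinearMap.const ℝ unitInterval z.1.2 - z.1.1 • primitiveL E (V.comp z.2)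

theorem integralDefect_eq_zero_iff (V : C(E, E)) (t : ℝ) (x : E) (u : C(unitInterval, E)) :
    integralDefect V ((t, x), u) = 0 ↔
      ∀ s, u s = x + t • ContinuousMap.primitiveL E (V.comp u) s := by
  rw [ContinuousMap.ext_iff]
  refine forall_congr' fun s => ?_
  change u s - x - t • ContinuousMap.primitiveL E (V.comp u) s = 0 ↔ _
  rw [sub_sub, sub_eq_zero]

/-- An initial piece of an integral curve is itself one, over the shorter time `s * t`. -/
theorem integralDefect_rescale_eq_zero {V : C(E, E)} {t : ℝ} {x : E} {u : C(unitInterval, E)}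
    (h : integralDefect V ((t, x), u) = 0) (s : unitInterval) :
    integralDefect V ((s * t, x), u.rescale s) = 0 := by
  rw [integralDefect_eq_zero_iff] at h ⊢
  intro τ
  have : V.comp (u.rescale s) = (V.comp u).rescale s := rfl
  rw [ContinuousMap.rescale_apply, h, this, mul_comm (s : ℝ) t, mul_smul,
    ContinuousMap.primitiveL_rescale]

theorem contDiff_primitiveL_comp {V : C(E, E)} (hV : ContDiff ℝ ∞ V) :
    ContDiff ℝ ∞ fun u : C(unitInterval, E) => ContinuousMap.primitiveL E (V.comp u) :=
  (ContinuousMap.primitiveL E).contDiff.comp (ContinuousMap.contDiff_comp_left V hV)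

theorem contDiff_integralDefect {V : C(E, E)} (hV : ContDiff ℝ ∞ V) :
    ContDiff ℝ ∞ (integralDefect V) := by
  have h := (contDiff_primitiveL_comp hV).comp
    (contDiff_snd (E := ℝ × E) (F := C(unitInterval, E)))
  have hc : ContDiff ℝ ∞ fun z : (ℝ × E) × C(unitInterval, E) =>
      ContinuousLinearMap.const ℝ unitInterval z.1.2 :=
    (ContinuousLinearMap.const ℝ unitInterval (M := E)).contDiff.comp
      (contDiff_snd.comp contDiff_fst)
  exact (contDiff_snd.sub hc).sub ((contDiff_fst.comp contDiff_fst).smul h)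

/-- The nonlinear term carries the factor `t`, so at `t = 0` it contributes nothing to the
derivative in the curve. The value of `A` is irrelevant later. -/
theorem hasFDerivAt_integralDefect {V : C(E, E)} (hV : ContDiff ℝ ∞ V) (p : E) :
    ∃ A : ℝ × E →L[ℝ] C(unitInterval, E),
      HasFDerivAt (integralDefect V)
        (ContinuousLinearMap.snd ℝ (ℝ × E) C(unitInterval, E) +
          A ∘L ContinuousLinearMap.fst ℝ (ℝ × E) C(unitInterval, E))
        ((0, p), ContinuousMap.const unitInterval p) := by
  set c := ContinuousMap.const unitInterval p
  let W : C(unitInterval, E) → C(unitInterval, E) :=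
    fun u => ContinuousMap.primitiveL E (V.comp u)
  have hW : HasFDerivAt W (fderiv ℝ W c) c :=
    ((contDiff_primitiveL_comp hV).differentiable (by simp) c).hasFDerivAt
  let z₀ : (ℝ × E) × C(unitInterval, E) := ((0, p), c)
  have hW' := hW.comp z₀ (hasFDerivAt_snd (𝕜 := ℝ) (E := ℝ × E) (F := C(unitInterval, E)))
  have ht := (hasFDerivAt_fst (𝕜 := ℝ) (E := ℝ) (F := E) (p := z₀.1)).comp z₀
    (hasFDerivAt_fst (𝕜 := ℝ) (E := ℝ × E) (F := C(unitInterval, E)))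
  have hx := ((ContinuousLinearMap.const ℝ unitInterval (M := E)).hasFDerivAt (x := z₀.1.2)).comp z₀
    ((hasFDerivAt_snd (𝕜 := ℝ) (E := ℝ) (F := E) (p := z₀.1)).comp z₀
    (hasFDerivAt_fst (𝕜 := ℝ) (E := ℝ × E) (F := C(unitInterval, E))))
  refine ⟨-(ContinuousLinearMap.const ℝ unitInterval ∘L ContinuousLinearMap.snd ℝ ℝ E) -
    (ContinuousLinearMap.fst ℝ ℝ E).smulRight (W c), ?_⟩
  refine (((hasFDerivAt_snd (p := z₀)).sub hx).sub (ht.smul hW')).congr_fderiv ?_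
  ext1
  · ext1 <;> ext <;> simp [z₀]
  · ext
    simp [z₀]

variable [CompleteSpace E]

/-- Local solutions of the rescaled integral equation, depending smoothly on time and initial value,
and locally unique. -/
theorem exists_smooth_solution_integralDefect {V : C(E, E)} (hV : ContDiff ℝ ∞ V) (p : E) :
    ∃ U : ℝ × E → C(unitInterval, E),
      U (0, p) = ContinuousMap.const unitInterval p ∧
      (∀ᶠ z in 𝓝 (0, p), ContDiffAt ℝ ∞ U z) ∧
      (∀ᶠ z in 𝓝 (0, p), integralDefect V (z, U z) = 0) ∧
      ∀ᶠ w in 𝓝 ((0, p), ContinuousMap.const unitInterval p),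
        integralDefect V w = 0 → U w.1 = w.2 := by
  obtain ⟨A, hA⟩ := hasFDerivAt_integralDefect hV p
  set c := ContinuousMap.const unitInterval p
  let Ψ : (ℝ × E) × C(unitInterval, E) → (ℝ × E) × C(unitInterval, E) :=
    fun w => (w.1, integralDefect V w)
  -- The derivative of `Ψ` is block triangular with identity diagonal, hence invertible for any `A`.
  let e := (ContinuousLinearEquiv.refl ℝ (ℝ × E)).skewProd
    (ContinuousLinearEquiv.refl ℝ C(unitInterval, E)) A
  have hΨ : ContDiff ℝ ∞ Ψ := contDiff_fst.prodMk (contDiff_integralDefect hV)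
  have hΨ' : HasFDerivAt Ψ (e : (ℝ × E) × C(unitInterval, E) →L[ℝ] _) ((0, p), c) :=
    (hasFDerivAt_fst.prodMk hA).congr_fderiv (by ext1 <;> ext <;> simp [e])
  obtain ⟨g, hg0, hgs, hgl, hgr⟩ := exists_localInverse_eventually_contDiffAt
    (Eventually.of_forall fun w => hΨ.contDiffAt) hΨ'
  have h0 : integralDefect V ((0, p), c) = 0 := by
    rw [integralDefect_eq_zero_iff]
    simp [c]
  have hΨ0 : Ψ ((0, p), c) = ((0, p), 0) := by simp only [Ψ, h0]
  rw [hΨ0] at hg0 hgs hgr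
  have hι : Tendsto (fun z : ℝ × E => (z, (0 : C(unitInterval, E)))) (𝓝 (0, p))
      (𝓝 ((0, p), 0)) := (Continuous.prodMk_left 0).continuousAt
  refine ⟨fun z => (g (z, 0)).2, congrArg Prod.snd hg0, ?_, ?_, ?_⟩
  · filter_upwards [hι.eventually hgs] with z hz
    exact contDiffAt_snd.comp z (hz.comp z (contDiffAt_id.prodMk contDiffAt_const))
  · filter_upwards [hι.eventually hgr] with z hz
    have h1 : (g (z, 0)).1 = z := congrArg Prod.fst hz
    have h2 : integralDefect V (g (z, 0)) = 0 := congrArg Prod.snd hz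
    rwa [← Prod.mk.eta (p := g (z, 0)), h1] at h2
  · filter_upwards [hgl] with w hw h
    have : Ψ w = (w.1, 0) := by simp only [Ψ, h]
    rw [this] at hw
    rw [hw]

/-- **Smooth local flow** of a smooth vector field on a Banach space. -/
theorem exists_smooth_local_flow {V : E → E} (hV : ContDiff ℝ ∞ V) (p : E) :
    ∃ φ : ℝ × E → E, (∀ᶠ z in 𝓝 (0, p), ContDiffAt ℝ ∞ φ z) ∧
      (∀ᶠ x in 𝓝 p, φ (0, x) = x) ∧
      ∀ᶠ z in 𝓝 ((0 : ℝ), p), HasDerivAt (fun t => φ (t, z.2)) (V (φ z)) z.1 := by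
  let V' : C(E, E) := ⟨V, hV.continuous⟩
  obtain ⟨U, hU0, hUs, hUsol, hUuniq⟩ := exists_smooth_solution_integralDefect (V := V') hV p
  set c := ContinuousMap.const unitInterval p
  have hφs : ∀ᶠ z in 𝓝 ((0 : ℝ), p), ContDiffAt ℝ ∞ (fun z => U z 1) z := by
    filter_upwards [hUs] with z hz
    exact (ContinuousMap.evalCLM ℝ (1 : unitInterval)).contDiff.contDiffAt.comp z hz
  obtain ⟨r, hr, huniq⟩ := Metric.eventually_nhds_iff_ball.1 hUuniq
  have hUnear : ∀ᶠ z in 𝓝 ((0 : ℝ), p), U z ∈ Metric.ball c r := by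
    have : ContinuousAt U (0, p) := hUs.self_of_nhds.continuousAt
    exact this.eventually (by rw [hU0]; exact Metric.ball_mem_nhds c hr)
  obtain ⟨ρ, hρ, hball⟩ := Metric.eventually_nhds_iff_ball.1
    ((hUsol.and (hUnear.and hφs)).and (Metric.ball_mem_nhds _ hr))
  have hscale : ∀ {t τ : ℝ} {x : E}, |τ| ≤ |t| → (t, x) ∈ Metric.ball ((0 : ℝ), p) ρ →
      (τ, x) ∈ Metric.ball ((0 : ℝ), p) ρ := by
    intro t τ x hτ h
    rw [← ball_prod_same, mem_prod, mem_ball_zero_iff, Real.norm_eq_abs] at h ⊢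
    exact ⟨hτ.trans_lt h.1, h.2⟩
  -- By local uniqueness, the endpoints of the rescaled solutions for varying time trace out a
  -- single curve.
  have hcurve : ∀ (t : ℝ) (x : E) (s : unitInterval), (t, x) ∈ Metric.ball ((0 : ℝ), p) ρ →
      U (s * t, x) 1 = U (t, x) s := by
    intro t x s h
    obtain ⟨⟨hsol, hnear, -⟩, -⟩ := hball _ h
    have hst : |(s : ℝ) * t| ≤ |t| := by
      rw [abs_mul, abs_of_nonneg s.2.1]
      exact mul_le_of_le_one_left (abs_nonneg t) s.2.2
    obtain ⟨-, hin⟩ := hball _ (hscale hst h)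
    have hmem : (((s : ℝ) * t, x), (U (t, x)).rescale s) ∈ Metric.ball ((0, p), c) r := by
      rw [← ball_prod_same]
      refine ⟨hin, ?_⟩
      rw [mem_ball_iff_norm] at hnear ⊢
      exact (ContinuousMap.norm_rescale_sub_const_le s _ p).trans_lt hnear
    have := huniq _ hmem (integralDefect_rescale_eq_zero hsol s)
    simp only at this
    rw [this, ContinuousMap.rescale_apply, mul_one]
  have hint : ∀ (t : ℝ) (x : E), (t, x) ∈ Metric.ball ((0 : ℝ), p) ρ →
      U (t, x) 1 = x + ∫ τ in (0 : ℝ)..t, V (U (τ, x) 1) := by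
    intro t x h
    have hsol := (integralDefect_eq_zero_iff _ _ _ _).1 (hball _ h).1.1 1
    rw [hsol, ContinuousMap.primitiveL_apply]
    have hsub := intervalIntegral.smul_integral_comp_mul_left (a := 0) (b := 1)
      (fun τ => V (U (τ, x) 1)) t
    rw [mul_zero, mul_one] at hsub
    rw [← hsub]
    congr 2
    refine intervalIntegral.integral_congr fun σ hσ => ?_
    rw [Icc.coe_one, uIcc_of_le zero_le_one] at hσ
    change Set.IccExtend _ (V'.comp (U (t, x))) σ = V (U (t * σ, x) 1)
    rw [Set.IccExtend_of_mem _ _ hσ, mul_comm t σ, hcurve t x ⟨σ, hσ⟩ h]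
    rfl
  refine ⟨fun z => U z 1, hφs, ?_, ?_⟩
  · have : Tendsto (fun x : E => ((0 : ℝ), x)) (𝓝 p) (𝓝 (0, p)) :=
      (Continuous.prodMk_right 0).continuousAt
    filter_upwards [this.eventually (Metric.ball_mem_nhds _ hρ)] with x hx
    rw [hint 0 x hx, intervalIntegral.integral_same, add_zero]
  · filter_upwards [Metric.ball_mem_nhds ((0 : ℝ), p) hρ] with ⟨t, x⟩ hz
    have hcont : ∀ τ : ℝ, (τ, x) ∈ Metric.ball ((0 : ℝ), p) ρ →
        ContinuousAt (fun τ => V (U (τ, x) 1)) τ := by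
      intro τ hτ
      have h1 : ContinuousAt (fun z => U z 1) (τ, x) := (hball _ hτ).1.2.2.continuousAt
      have h2 : ContinuousAt (fun τ : ℝ => (τ, x)) τ := (Continuous.prodMk_left x).continuousAt
      exact hV.continuous.continuousAt.comp (ContinuousAt.comp (f := fun τ : ℝ => (τ, x)) h1 h2)
    have hopen : IsOpen {τ : ℝ | (τ, x) ∈ Metric.ball ((0 : ℝ), p) ρ} :=
      Metric.isOpen_ball.preimage (Continuous.prodMk_left x)
    have hseg : uIcc 0 t ⊆ {τ : ℝ | (τ, x) ∈ Metric.ball ((0 : ℝ), p) ρ} := by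
      intro τ hτ
      refine hscale ?_ hz
      simpa using abs_sub_left_of_mem_uIcc hτ
    have hder := intervalIntegral.integral_hasDerivAt_right
      (ContinuousOn.intervalIntegrable fun τ hτ => (hcont τ (hseg hτ)).continuousWithinAt)
      (ContinuousOn.stronglyMeasurableAtFilter hopen
        (fun τ hτ => (hcont τ hτ).continuousWithinAt) t hz) (hcont t hz)
    refine (hder.const_add x).congr_of_eventuallyEq ?_
    filter_upwards [hopen.mem_nhds hz] with τ hτ
    exact hint τ x hτ

end Flow

/-! ### First integrals in the plane -/

/-- In a plane, two covectors that vanish on a common nonzero vector are proportional. -/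
theorem eq_div_smul_of_apply_eq_zero {E : Type*} [NormedAddCommGroup E] [NormedSpace ℝ E]
    (hE : Module.finrank ℝ E = 2) {α β : E →L[ℝ] ℝ} {v w : E} (hv : v ≠ 0) (hα : α v = 0)
    (hβ : β v = 0) (hw : β w ≠ 0) : α = (α w / β w) • β := by
  have hli : LinearIndependent ℝ ![v, w] := by
    refine LinearIndependent.pair_iff.2 fun a b hab => ?_
    have hb : b = 0 := by simpa [hβ, hw] using congrArg β hab
    refine ⟨?_, hb⟩
    simpa [hb, hv] using hab
  have hcard : Fintype.card (Fin 2) = Module.finrank ℝ E := by simp [hE]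
  let b := basisOfLinearIndependentOfCardEqFinrank hli hcard
  refine ContinuousLinearMap.coe_injective (b.ext fun i => ?_)
  fin_cases i
  · simp [b, hα, hβ]
  · simp [b, hw]

/-- **Local first integrals** of a smooth vector field in the plane: if `V p` and `w` are
independent, there is a smooth function near `p` that is constant along `V` and has derivative `1`
at `p` in the direction `w`. -/
theorem exists_local_first_integral {E : Type*} [NormedAddCommGroup E] [NormedSpace ℝ E]
    (hE : Module.finrank ℝ E = 2) {V : E → E} (hV : ContDiff ℝ ∞ V) {p w : E}
    (hw : LinearIndependent ℝ ![V p, w]) :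
    ∃ ψ : E → ℝ, (∀ᶠ x in 𝓝 p, ContDiffAt ℝ ∞ ψ x) ∧ fderiv ℝ ψ p w = 1 ∧
      ∀ᶠ x in 𝓝 p, fderiv ℝ ψ x (V x) = 0 := by
  have : FiniteDimensional ℝ E := Module.finite_of_finrank_eq_succ hE
  have : CompleteSpace E := FiniteDimensional.complete ℝ E
  obtain ⟨φ, hφs, hφ0, hφ'⟩ := exists_smooth_local_flow hV p
  let ι : ℝ × ℝ → ℝ × E := fun z => (z.1, p + z.2 • w)
  have hι : ContDiff ℝ ∞ ι := by fun_prop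
  -- Flow-box coordinates: flow for time `z.1` from the transversal `p + z.2 • w`. The first
  -- integral is the second coordinate of the inverse.
  let χ : ℝ × ℝ → E := fun z => φ (ι z)
  have hι0 : ι (0, 0) = (0, p) := by simp [ι]
  have hιt : Tendsto ι (𝓝 (0, 0)) (𝓝 (0, p)) := hι0 ▸ hι.continuous.continuousAt
  have hχs : ∀ᶠ z in 𝓝 (0, 0), ContDiffAt ℝ ∞ χ z := by
    filter_upwards [hιt.eventually hφs] with z hz
    exact hz.comp z hι.contDiffAt
  have hχt : ∀ᶠ z in 𝓝 (0, 0), fderiv ℝ χ z (1, 0) = V (χ z) := by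
    filter_upwards [hιt.eventually hφ', hχs] with z hz hs
    have h1 : HasDerivAt (fun t : ℝ => (t, z.2)) ((1, 0) : ℝ × ℝ) z.1 :=
      (hasDerivAt_id z.1).prodMk (hasDerivAt_const z.1 z.2)
    have h2 : HasFDerivAt χ (fderiv ℝ χ z) (z.1, z.2) :=
      (hs.differentiableAt (by simp)).hasFDerivAt
    have h3 : HasDerivAt (fun t => χ (t, z.2)) (fderiv ℝ χ z (1, 0)) z.1 :=
      HasFDerivAt.comp_hasDerivAt (f := fun t : ℝ => (t, z.2)) (l := χ) z.1 h2 h1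
    exact h3.unique hz
  have hχ0 : χ (0, 0) = p := by
    simp only [χ, hι0]
    exact hφ0.self_of_nhds
  have hχw : fderiv ℝ χ (0, 0) (0, 1) = w := by
    have h1 : HasDerivAt (fun s : ℝ => ((0 : ℝ), s)) ((0, 1) : ℝ × ℝ) 0 :=
      (hasDerivAt_const 0 0).prodMk (hasDerivAt_id 0)
    have h2 : HasDerivAt (fun s : ℝ => p + s • w) w 0 := by
      simpa using ((hasDerivAt_id (0 : ℝ)).smul_const w).const_add p
    have h3 : Tendsto (fun s : ℝ => p + s • w) (𝓝 0) (𝓝 p) := by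
      simpa using h2.continuousAt.tendsto
    refine ((hχs.self_of_nhds.differentiableAt (by simp)).hasFDerivAt.comp_hasDerivAt 0 h1).unique
      (h2.congr_of_eventuallyEq ?_)
    exact h3.eventually hφ0
  have hinj : Function.Injective (fderiv ℝ χ (0, 0)) := by
    refine (injective_iff_map_eq_zero _).2 fun z hz => ?_
    have hz' : z = z.1 • ((1, 0) : ℝ × ℝ) + z.2 • ((0, 1) : ℝ × ℝ) := by ext <;> simp
    rw [hz', map_add, map_smul, map_smul, hχw, hχt.self_of_nhds, hχ0] at hz
    obtain ⟨h1, h2⟩ := LinearIndependent.pair_iff.1 hw _ _ hz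
    exact Prod.ext h1 h2
  let e : (ℝ × ℝ) ≃L[ℝ] E := ((fderiv ℝ χ (0, 0)).toLinearMap.linearEquivOfInjective hinj
    (by simp [hE])).toContinuousLinearEquiv
  have he : HasFDerivAt χ (e : ℝ × ℝ →L[ℝ] E) (0, 0) :=
    (hχs.self_of_nhds.differentiableAt (by simp)).hasFDerivAt.congr_fderiv (by ext <;> rfl)
  obtain ⟨g, hg0, hgs, hgl, hgr⟩ := exists_localInverse_eventually_contDiffAt hχs he
  rw [hχ0] at hg0 hgs hgr
  have hgt : Tendsto g (𝓝 p) (𝓝 (0, 0)) := hg0 ▸ hgs.self_of_nhds.continuousAt.tendsto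
  have hχc : Tendsto χ (𝓝 (0, 0)) (𝓝 p) := by
    simpa only [hχ0] using hχs.self_of_nhds.continuousAt.tendsto
  have hψs : ∀ᶠ x in 𝓝 p, ContDiffAt ℝ ∞ (fun x => (g x).2) x := by
    filter_upwards [hgs] with x hx
    exact contDiffAt_snd.comp x hx
  have hψχ : ∀ᶠ z in 𝓝 (0, 0), ∀ y, fderiv ℝ (fun x => (g x).2) (χ z) (fderiv ℝ χ z y) = y.2 := by
    filter_upwards [hgl.eventually_nhds, hχs, hχc.eventually hψs] with z hz hs hψ y
    have h1 := (hψ.differentiableAt (by simp)).hasFDerivAt.comp z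
      (hs.differentiableAt (by simp)).hasFDerivAt
    have h2 : HasFDerivAt (fun z => (g (χ z)).2) (ContinuousLinearMap.snd ℝ ℝ ℝ) z :=
      hasFDerivAt_snd.congr_of_eventuallyEq (hz.mono fun z' h => congrArg Prod.snd h)
    exact congrArg (fun L : ℝ × ℝ →L[ℝ] ℝ => L y) (h1.unique h2)
  refine ⟨fun x => (g x).2, hψs, ?_, ?_⟩
  · have := hψχ.self_of_nhds (0, 1)
    rwa [hχ0, hχw] at this
  · filter_upwards [hgr, hgt.eventually hψχ, hgt.eventually hχt] with x hx h1 h2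
    have := h1 (1, 0)
    rwa [h2, hx] at this

/-- A function smooth on an open set agrees near each point of it with a globally smooth
function. -/
theorem exists_contDiff_eventuallyEq {E F : Type*} [NormedAddCommGroup E] [NormedSpace ℝ E]
    [FiniteDimensional ℝ E] [NormedAddCommGroup F] [NormedSpace ℝ F] {f : E → F} {s : Set E}
    (hs : IsOpen s) (hf : ContDiffOn ℝ ∞ f s) {p : E} (hp : p ∈ s) :
    ∃ g : E → F, ContDiff ℝ ∞ g ∧ g =ᶠ[𝓝 p] f := by
  obtain ⟨r, hr, hrs⟩ := Metric.nhds_basis_closedBall.mem_iff.1 (hs.mem_nhds hp)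
  let ρ : ContDiffBump p := ⟨r / 2, r, half_pos hr, half_lt_self hr⟩
  refine ⟨fun x => ρ x • f x, contDiff_iff_contDiffAt.2 fun x => ?_, ?_⟩
  · by_cases hx : x ∈ s
    · exact ρ.contDiffAt.smul (hf.contDiffAt (hs.mem_nhds hx))
    · have hx' : x ∉ tsupport ρ := fun h => hx (hrs (ρ.tsupport_eq ▸ h))
      refine contDiffAt_const (c := (0 : F)) |>.congr_of_eventuallyEq ?_
      filter_upwards [notMem_tsupport_iff_eventuallyEq.1 hx'] with y hy
      rw [hy, Pi.zero_apply, zero_smul]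
  · filter_upwards [ρ.eventuallyEq_one] with x hx
    rw [hx, Pi.one_apply, one_smul]

/-! ### Pfaffian forms in two variables -/

namespace PfaffianForm

theorem toCovector_apply_two {B : Set (EuclideanSpace ℝ (Fin 2))} (ξ : PfaffianForm 2 B)
    (x v : EuclideanSpace ℝ (Fin 2)) :
    ξ.toCovector x v = ξ.coeff 0 x * v 0 + ξ.coeff 1 x * v 1 := by
  simp [toCovector]

theorem contDiffOn_toCovector_apply {n : ℕ} {B : Set (EuclideanSpace ℝ (Fin n))}
    (ξ : PfaffianForm n B) (v : EuclideanSpace ℝ (Fin n)) :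
    ContDiffOn ℝ ∞ (fun x => ξ.toCovector x v) B := by
  simp only [toCovector, sum_apply, smul_apply]
  exact ContDiffOn.sum fun i _ => (ξ.smooth i).smul contDiffOn_const

/-- The vector field `(F₂, -F₁)`, which spans the kernel of `F₁ dx₁ + F₂ dx₂`. -/
noncomputable def kernelField {B : Set (EuclideanSpace ℝ (Fin 2))} (ξ : PfaffianForm 2 B)
    (x : EuclideanSpace ℝ (Fin 2)) : EuclideanSpace ℝ (Fin 2) :=
  !₂[ξ.coeff 1 x, -ξ.coeff 0 x]

theorem contDiffOn_kernelField {B : Set (EuclideanSpace ℝ (Fin 2))} (ξ : PfaffianForm 2 B) :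
    ContDiffOn ℝ ∞ ξ.kernelField B := by
  refine contDiffOn_euclidean.2 fun i => ?_
  fin_cases i
  · exact ξ.smooth 1
  · exact (ξ.smooth 0).neg

theorem toCovector_kernelField {B : Set (EuclideanSpace ℝ (Fin 2))} (ξ : PfaffianForm 2 B)
    (x : EuclideanSpace ℝ (Fin 2)) : ξ.toCovector x (ξ.kernelField x) = 0 := by
  simp only [toCovector_apply_two, kernelField, Matrix.cons_val_zero, Matrix.cons_val_one]
  ring

theorem kernelField_ne_zero {B : Set (EuclideanSpace ℝ (Fin 2))} {ξ : PfaffianForm 2 B}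
    {x : EuclideanSpace ℝ (Fin 2)} (hx : ξ.toCovector x ≠ 0) : ξ.kernelField x ≠ 0 := by
  contrapose! hx
  have h0 : ξ.coeff 1 x = 0 := congrArg (fun v : EuclideanSpace ℝ (Fin 2) => v 0) hx
  have h1 : -ξ.coeff 0 x = 0 := congrArg (fun v : EuclideanSpace ℝ (Fin 2) => v 1) hx
  ext v
  simp [toCovector_apply_two, h0, neg_eq_zero.1 h1]

end PfaffianForm

theorem theorem1 (B : Set (EuclideanSpace ℝ (Fin 2))) (hB : IsOpen B)
    (ξ : PfaffianForm 2 B) (hξ : ξ.NonSingular) : ξ.LocallyIntegrable := by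
  intro p hp
  have hdim : Module.finrank ℝ (EuclideanSpace ℝ (Fin 2)) = 2 := by simp
  obtain ⟨w, hw⟩ : ∃ w, ξ.toCovector p w ≠ 0 := by
    by_contra! h
    exact hξ p hp (ContinuousLinearMap.ext h)
  -- The flow is built for globally smooth fields, so the kernel field is first cut off away from
  -- `p`.
  obtain ⟨V, hV, hVξ⟩ := exists_contDiff_eventuallyEq hB ξ.contDiffOn_kernelField hp
  have hli : LinearIndependent ℝ ![V p, w] := by
    rw [hVξ.self_of_nhds]
    refine LinearIndependent.pair_iff.2 fun a b hab => ?_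
    have hb : b = 0 := by
      simpa [ξ.toCovector_kernelField, hw] using congrArg (ξ.toCovector p) hab
    refine ⟨?_, hb⟩
    simpa [hb, PfaffianForm.kernelField_ne_zero (hξ p hp)] using hab
  obtain ⟨ψ, hψs, hψw, hψV⟩ := exists_local_first_integral hdim hV hli
  have hψ' : ∀ᶠ x in 𝓝 p, ContDiffAt ℝ ∞ (fun x => fderiv ℝ ψ x w) x := by
    filter_upwards [hψs] with x hx
    exact (hx.fderiv_right (by simp)).clm_apply contDiffAt_const
  have hξs : ∀ᶠ x in 𝓝 p, ContDiffAt ℝ ∞ (fun x => ξ.toCovector x w) x := by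
    filter_upwards [hB.mem_nhds hp] with x hx
    exact (ξ.contDiffOn_toCovector_apply w).contDiffAt (hB.mem_nhds hx)
  have hψne : ∀ᶠ x in 𝓝 p, fderiv ℝ ψ x w ≠ 0 :=
    hψ'.self_of_nhds.continuousAt.eventually_ne (by rw [hψw]; exact one_ne_zero)
  have hξne : ∀ᶠ x in 𝓝 p, ξ.toCovector x w ≠ 0 :=
    hξs.self_of_nhds.continuousAt.eventually_ne hw
  have hBp : ∀ᶠ x in 𝓝 p, x ∈ B := hB.mem_nhds hp
  obtain ⟨M, hM, hMopen, hpM⟩ := eventually_nhds_iff.1 (hBp.and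
    (hVξ.and (hψs.and (hψV.and (hψ'.and (hξs.and (hψne.and hξne)))))))
  refine ⟨M, hMopen, hpM, fun x hx => (hM x hx).1,
    -- Evaluating `ξ = μ dψ` on the fixed vector `w` forces this `μ`.
    fun x => ξ.toCovector x w / fderiv ℝ ψ x w, ψ, ?_, ?_, ?_, ?_⟩
  all_goals
    intro x hx
    obtain ⟨hxB, hxV, hxψ, hxψV, hxψ', hxξ, hxψw, hxξw⟩ := hM x hx
  · exact (hxξ.div hxψ' hxψw).contDiffWithinAt
  · exact hxψ.contDiffWithinAt
  · exact div_ne_zero hxξw hxψw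
  · rw [hxV] at hxψV
    exact eq_div_smul_of_apply_eq_zero hdim (PfaffianForm.kernelField_ne_zero (hξ x hxB))
      (ξ.toCovector_kernelField x) hxψV hxψw
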